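/- There exist absolute constants $c_0,c_1,c_2>0$ for which the following holds. Let $(\mathcal X,\mu)$ be a probability space, let $X$ be a random variable distributed according to $\mu$, and let $Y$ be a real-valued random variable with $\mathbb E Y^2<\infty$. Let $F=\{f_1,\dots,f_M\}$ be a finite family of functions in $L_2(\mu)$, let ${\rm span}(F)$ be its linear span, put $\|f\|_{L_p}=(\mathbb E|f(X)|^p)^{1/p}$ and $R(f)=\mathbb E(Y-f(X))^2$, and let $f^*\in{\rm span}(F)$ satisfy $R(f^*)=\min_{f\in{\rm span}(F)}R(f)$. Assume that $\theta_0>0$ is such that $$\|f\|_{L_4}\le\theta_0\|f\|_{L_2}\qquad\text{for every } f\in{\rm span}(F).$$ Set $\zeta=Y-f^*(X)$, assume that $\mathbb E\zeta^4<\infty$ and put $\sigma=(\mathbb E\zeta^4)^{1/4}$ ($\zeta$ may depend on $X$ and need not be bounded). Let $N\ge1$ be an integer with $N\ge(c_0\theta_0^4)^2M$, let $(X_i,Y_i)_{i=1}^N$ be independent copies of $(X,Y)$, and let $\hat f$ be any empirical risk minimizer, that is, $$\hat f\in\mathop{\rm argmin}_{f\in{\rm span}(F)}\frac1N\sum_{i=1}^N\big(Y_i-f(X_i)\big)^2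 .$$ Then, for every $x>0$, with probability at least $1-\exp\big(-N/(c_1\theta_0^8)\big)-1/x$, $$\|\hat f-f^*\|_{L_2}^2=R(\hat f)-\min_{f\in{\rm span}(F)}R(f)\le c_2\theta_0^{12}\,\frac{\sigma^2Mx}{N}.$$ Here $R(\hat f)=\mathbb E\big((Y-\hat f(X))^2\mid (X_i,Y_i)_{i=1}^N\big)$, where $(X,Y)$ is independent of the sample, is the risk of the function selected from the sample; likewise $\|\hat f-f^*\|_{L_2}$ is computed with the sample held fixed. -/

import Mathlib

open MeasureTheory ProbabilityTheory

namespace LinearAggregation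

/-- The linear span of the dictionary `F = {f₁, …, f_M}`, as a space of functions on `𝒳`. -/
def dictSpan {𝒳 : Type*} {M : ℕ} (F : Fin M → 𝒳 → ℝ) : Submodule ℝ (𝒳 → ℝ) :=
  Submodule.span ℝ (Set.range F)

/-- The squared risk `R(f) = 𝔼 (Y - f(X))²`. The risk `R(f̂)` of a data-dependent function `f̂` is
its value at the realised function, that is, the conditional expectation given the sample. -/
noncomputable def risk {Ω₀ 𝒳 : Type*} [MeasurableSpace Ω₀] (P₀ : Measure Ω₀)
    (X : Ω₀ → 𝒳) (Y : Ω₀ → ℝ) (f : 𝒳 → ℝ) : ℝ :=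
  ∫ ω, (Y ω - f (X ω)) ^ 2 ∂P₀

/-- The empirical risk `R_N(f) = (1/N) ∑ᵢ (yᵢ - f(xᵢ))²` on the data points `(xᵢ, yᵢ)`. -/
noncomputable def empiricalRisk {𝒳 : Type*} {N : ℕ} (x : Fin N → 𝒳) (y : Fin N → ℝ)
    (f : 𝒳 → ℝ) : ℝ :=
  (1 / (N : ℝ)) * ∑ i, (y i - f (x i)) ^ 2

/-- `f` is an oracle: it lies in `span(F)` and minimises the risk there. -/
def IsOracle {Ω₀ 𝒳 : Type*} [MeasurableSpace Ω₀] (P₀ : Measure Ω₀)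
    (X : Ω₀ → 𝒳) (Y : Ω₀ → ℝ) {M : ℕ} (F : Fin M → 𝒳 → ℝ) (f : 𝒳 → ℝ) : Prop :=
  f ∈ dictSpan F ∧ ∀ g ∈ dictSpan F, risk P₀ X Y f ≤ risk P₀ X Y g

/-- `f` is an empirical risk minimiser: it lies in `span(F)` and minimises the empirical risk
there. -/
def IsERM {𝒳 : Type*} {N M : ℕ} (x : Fin N → 𝒳) (y : Fin N → ℝ) (F : Fin M → 𝒳 → ℝ)
    (f : 𝒳 → ℝ) : Prop :=
  f ∈ dictSpan F ∧ ∀ g ∈ dictSpan F, empiricalRisk x y f ≤ empiricalRisk x y g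

end LinearAggregation

/-!
Choose an orthonormal system of `L²(μ)` spanning the dictionary, of dimension `d ≤ M`. A function of
the span becomes a vector `t`, its `L²(μ)` norm becomes `‖t‖`, and the feature vectors `φ(Xᵢ)`
become isotropic with fourth moments bounded by `θ⁴`.

* The quadratic process `∑ᵢ ⟪t, φ(Xᵢ)⟫²` is at least `N / 8 * ‖t‖²` for all `t` at once, up to
  probability `exp (-N / (64 θ⁴))`: for one `t` this is a lower-tail bound for sums of nonnegative
  variables, which needs no more than fourth moments, and a union bound over a net gives all `t`.
  Since the features are unbounded, the passage from the net to an arbitrary `t` is done for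
  features truncated in norm, which only decreases the quadratic process; the point of the net is
  found by rounding the coordinates of `t` at random, on average over which the truncated quadratic
  process increases by a controlled amount.
* An empirical risk minimiser with error vector `t` satisfies `∑ᵢ ⟪t, φ(Xᵢ)⟫² ≤ 2 ⟪t, Z⟫`, where `Z`
  is the sum of the vectors `ζᵢ φ(Xᵢ)`. They are centred because `f*` minimises the risk, so
  `𝔼 ‖Z‖² ≤ N d θ² σ²`, and Markov's inequality bounds `‖Z‖` up to probability `1 / x`.

Combining the two gives `N / 8 * ‖t‖² ≤ 2 ‖t‖ ‖Z‖`. If `θ₀ < 1`, all functions of the span vanish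
almost everywhere.
-/

namespace LinearAggregation

open Finset Metric
open scoped RealInnerProductSpace

section IntegerPoints

lemma sum_Icc_neg_two_inv_pow_natAbs_le (n : ℕ) :
    ∑ m ∈ Icc (-(n : ℤ)) n, (1 / 2 : ℝ) ^ m.natAbs ≤ 3 := by
  have heven : Function.Even fun m : ℤ => (1 / 2 : ℝ) ^ m.natAbs := fun m => by
    simp only [Int.natAbs_neg]
  rw [sum_Icc_of_even_eq_range heven]
  have hgeom := sum_geometric_two_le (n + 1)
  simp only [Int.natAbs_natCast, Int.natAbs_zero, pow_zero, nsmul_eq_mul, Nat.cast_ofNat]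
  linarith

/-- Weighting each integer point `m` by `∏ₖ 2 ^ (-|mₖ|)`, the weights of a box sum to at most
`3 ^ card ι`, while each point of the `ℓ₁` ball has weight at least `2 ^ (-n)`. -/
lemma exists_finset_sum_natAbs_le_mem {ι : Type*} [Fintype ι] (n : ℕ) :
    ∃ T : Finset (ι → ℤ), (∀ m : ι → ℤ, ∑ k, (m k).natAbs ≤ n → m ∈ T) ∧
      (#T : ℝ) ≤ 2 ^ n * 3 ^ Fintype.card ι := by
  classical
  set box : Finset (ι → ℤ) := Fintype.piFinset fun _ => Icc (-(n : ℤ)) n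
  refine ⟨box.filter fun m => ∑ k, (m k).natAbs ≤ n, fun m hm => ?_, ?_⟩
  · refine mem_filter.2 ⟨Fintype.mem_piFinset.2 fun k => mem_Icc.2 ?_, hm⟩
    have hk : (m k).natAbs ≤ n :=
      (single_le_sum (f := fun k => (m k).natAbs) (fun _ _ => Nat.zero_le _) (mem_univ k)).trans hm
    omega
  · have hweight : ∀ m : ι → ℤ, ∑ k, (m k).natAbs ≤ n →
        (1 : ℝ) ≤ 2 ^ n * ∏ k, (1 / 2) ^ (m k).natAbs := fun m hm => by
      rw [prod_pow_eq_pow_sum, one_div, inv_pow, ← div_eq_mul_inv, one_le_div (by positivity)]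
      exact pow_le_pow_right₀ one_le_two hm
    calc (#(box.filter fun m => ∑ k, (m k).natAbs ≤ n) : ℝ)
        = ∑ m ∈ box with ∑ k, (m k).natAbs ≤ n, (1 : ℝ) := by
          rw [sum_const, nsmul_eq_mul, mul_one]
      _ ≤ ∑ m ∈ box with ∑ k, (m k).natAbs ≤ n, 2 ^ n * ∏ k, (1 / 2 : ℝ) ^ (m k).natAbs :=
          sum_le_sum fun m hm => hweight m (mem_filter.1 hm).2
      _ ≤ ∑ m ∈ box, 2 ^ n * ∏ k, (1 / 2 : ℝ) ^ (m k).natAbs :=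
          sum_le_sum_of_subset_of_nonneg (filter_subset _ _) fun _ _ _ => by positivity
      _ = 2 ^ n * ∏ _k : ι, ∑ j ∈ Icc (-(n : ℤ)) n, (1 / 2 : ℝ) ^ j.natAbs := by
          rw [← mul_sum, prod_univ_sum]
      _ ≤ 2 ^ n * 3 ^ Fintype.card ι := by
          rw [prod_const, card_univ]
          gcongr
          exact sum_Icc_neg_two_inv_pow_natAbs_le n

lemma exists_finset_sum_sq_le_mem {ι : Type*} [Fintype ι] {R : ℝ} (hR : 0 ≤ R) :
    ∃ T : Finset (ι → ℤ), (∀ m : ι → ℤ, ∑ k, (m k : ℝ) ^ 2 ≤ R → m ∈ T) ∧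
      (#T : ℝ) ≤ Real.exp (R + 2 * Fintype.card ι) := by
  obtain ⟨T, hT, hcard⟩ := exists_finset_sum_natAbs_le_mem (ι := ι) ⌊R⌋₊
  refine ⟨T, fun m hm => hT m (Nat.le_floor ?_), hcard.trans ?_⟩
  · push_cast
    refine (sum_le_sum fun k _ => ?_).trans hm
    rw [Nat.cast_natAbs]
    exact_mod_cast Int.natAbs_le_self_sq (m k)
  · have htwo : (2 : ℝ) ≤ Real.exp 1 := by linarith [Real.add_one_le_exp (1 : ℝ)]
    have hthree : (3 : ℝ) ≤ Real.exp 2 := by linarith [Real.add_one_le_exp (2 : ℝ)]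
    calc (2 : ℝ) ^ ⌊R⌋₊ * 3 ^ Fintype.card ι
        ≤ Real.exp 1 ^ ⌊R⌋₊ * Real.exp 2 ^ Fintype.card ι := by gcongr
      _ = Real.exp (⌊R⌋₊ + 2 * Fintype.card ι) := by
          rw [← Real.exp_nat_mul, ← Real.exp_nat_mul, ← Real.exp_add, mul_one, mul_comm 2]
      _ ≤ Real.exp (R + 2 * Fintype.card ι) := by
          gcongr
          exact Nat.floor_le hR

end IntegerPoints

section Rounding

/-- Rounding `y` down with probability `1 - p` and up with probability `p`, where `p` is the
fractional part of `y / h`, gives a centred increment of variance `h² p (1 - p) ≤ h² / 4`. -/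
lemma exists_int_mul_round_quadratic_le {h : ℝ} (hh : 0 < h) (y b : ℝ) {c C : ℝ} (hcC : c ≤ C)
    (hC : 0 ≤ C) :
    ∃ s : ℝ, (∃ m : ℤ, y + s = h * m) ∧ |s| ≤ h ∧ s * b + s ^ 2 * c ≤ h ^ 2 / 4 * C := by
  set p := Int.fract (y / h)
  have hp0 : 0 ≤ p := Int.fract_nonneg _
  have hp1 : 0 < 1 - p := sub_pos.2 (Int.fract_lt_one _)
  have hy : y = h * (⌊y / h⌋ + p) := by
    rw [Int.floor_add_fract, mul_div_cancel₀ _ hh.ne']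
  by_contra! hlt
  have hdown := hlt (-(h * p)) ⟨⌊y / h⌋, by linear_combination hy⟩
    (by rw [abs_neg, abs_of_nonneg (by positivity)]; nlinarith)
  have hup := hlt (h * (1 - p)) ⟨⌊y / h⌋ + 1, by push_cast; linear_combination hy⟩
    (by rw [abs_of_nonneg (by positivity)]; nlinarith)
  have havg : h ^ 2 / 4 * C < h ^ 2 * (p * (1 - p)) * c := by
    calc h ^ 2 / 4 * C = (1 - p) * (h ^ 2 / 4 * C) + p * (h ^ 2 / 4 * C) := by ring
      _ < (1 - p) * (-(h * p) * b + (-(h * p)) ^ 2 * c) +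
            p * (h * (1 - p) * b + (h * (1 - p)) ^ 2 * c) :=
          add_lt_add_of_lt_of_le (mul_lt_mul_of_pos_left hdown hp1)
            (mul_le_mul_of_nonneg_left hup.le hp0)
      _ = h ^ 2 * (p * (1 - p)) * c := by ring
  have hvar : p * (1 - p) ≤ 1 / 4 := by nlinarith [sq_nonneg (p - 1 / 2)]
  have hle : h ^ 2 * (p * (1 - p)) * c ≤ h ^ 2 / 4 * C :=
    calc h ^ 2 * (p * (1 - p)) * c ≤ h ^ 2 * (p * (1 - p)) * C := by gcongr
      _ ≤ h ^ 2 * (1 / 4) * C := by gcongr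
      _ = h ^ 2 / 4 * C := by ring
  exact havg.not_ge hle

variable {ι V : Type*} [AddCommGroup V] [Module ℝ V]

lemma exists_round_coords_quadraticForm_le (Q : QuadraticForm ℝ V) (b : Module.Basis ι ℝ V)
    {C : ι → ℝ} (hQC : ∀ k, Q (b k) ≤ C k) (hC : ∀ k, 0 ≤ C k) {h : ℝ} (hh : 0 < h) (v : V)
    (T : Finset ι) :
    ∃ u : V, (∀ k ∈ T, (∃ m : ℤ, b.repr u k = h * m) ∧ |b.repr u k - b.repr v k| ≤ h) ∧
      (∀ k ∉ T, b.repr u k = b.repr v k) ∧ Q u ≤ Q v + h ^ 2 / 4 * ∑ k ∈ T, C k := by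
  classical
  induction T using Finset.induction_on with
  | empty => exact ⟨v, by simp, by simp, by simp⟩
  | insert k T hk ih =>
    obtain ⟨u, hround, hfixed, hle⟩ := ih
    obtain ⟨s, hint, habs, hincr⟩ := exists_int_mul_round_quadratic_le hh (b.repr u k)
      (QuadraticMap.polar Q u (b k)) (hQC k) (hC k)
    have hrepr : ∀ l, b.repr (u + s • b k) l = b.repr u l + if k = l then s else 0 := fun l => by
      simp [Finsupp.single_apply]
    refine ⟨u + s • b k, fun l hl => ?_, fun l hl => ?_, ?_⟩
    · rw [hrepr]
      rcases eq_or_ne k l with rfl | hkl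
      · rw [if_pos rfl, ← hfixed k hk, add_sub_cancel_left]
        exact ⟨hint, habs⟩
      · rw [if_neg hkl, add_zero]
        exact hround l (mem_of_mem_insert_of_ne hl hkl.symm)
    · rw [mem_insert, not_or] at hl
      rw [hrepr, if_neg (Ne.symm hl.1), add_zero, hfixed l hl.2]
    · have hexpand :
          Q (u + s • b k) = Q u + (s * QuadraticMap.polar Q u (b k) + s ^ 2 * Q (b k)) := by
        rw [QuadraticMap.map_add (⇑Q), QuadraticMap.map_smul, QuadraticMap.polar_smul_right]
        simp only [smul_eq_mul]
        ring
      rw [hexpand, sum_insert hk]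
      linarith

end Rounding

section LowerTail

lemma exp_neg_le_one_sub_add_sq {z : ℝ} (hz : 0 ≤ z) : Real.exp (-z) ≤ 1 - z + z ^ 2 / 2 := by
  have hquad := Real.quadratic_le_exp_of_nonneg hz
  rw [Real.exp_neg, inv_le_iff_one_le_mul₀ (Real.exp_pos z)]
  have hpos : 0 ≤ 1 - z + z ^ 2 / 2 := by nlinarith [sq_nonneg (z - 1)]
  nlinarith [mul_le_mul_of_nonneg_left hquad hpos, sq_nonneg (z ^ 2)]

variable {Ω : Type*} [MeasurableSpace Ω] {P : Measure Ω} [IsProbabilityMeasure P]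

lemma integrable_exp_neg_mul {Y : Ω → ℝ} (hY : AEMeasurable Y P) (hY0 : ∀ ω, 0 ≤ Y ω) {c : ℝ}
    (hc : 0 ≤ c) : Integrable (fun ω => Real.exp (-c * Y ω)) P := by
  refine Integrable.of_bound (by fun_prop) 1 (.of_forall fun ω => ?_)
  rw [Real.norm_of_nonneg (Real.exp_pos _).le, Real.exp_le_one_iff, neg_mul, neg_nonpos]
  exact mul_nonneg hc (hY0 ω)

lemma mgf_neg_le_exp {Y : Ω → ℝ} (hY : MemLp Y 2 P) (hY0 : ∀ ω, 0 ≤ Y ω) {c : ℝ} (hc : 0 ≤ c) :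
    mgf Y P (-c) ≤ Real.exp (c ^ 2 / 2 * ∫ ω, Y ω ^ 2 ∂P - c * ∫ ω, Y ω ∂P) := by
  have hint : Integrable Y P := hY.integrable one_le_two
  have hlin : Integrable (fun ω => 1 - c * Y ω) P := (integrable_const 1).sub (hint.const_mul c)
  have hsq : Integrable (fun ω => c ^ 2 / 2 * Y ω ^ 2) P := hY.integrable_sq.const_mul _
  calc mgf Y P (-c) ≤ ∫ ω, (1 - c * Y ω + c ^ 2 / 2 * Y ω ^ 2) ∂P := by
        refine integral_mono (integrable_exp_neg_mul hY.aemeasurable hY0 hc) (hlin.add hsq)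
          fun ω => ?_
        have hexp := exp_neg_le_one_sub_add_sq (mul_nonneg hc (hY0 ω))
        rw [mul_pow, ← neg_mul] at hexp
        linarith
    _ = c ^ 2 / 2 * ∫ ω, Y ω ^ 2 ∂P - c * ∫ ω, Y ω ∂P + 1 := by
        rw [integral_add hlin hsq, integral_sub (integrable_const 1) (hint.const_mul c),
          integral_const_mul, integral_const_mul, integral_const, probReal_univ, one_smul]
        ring
    _ ≤ _ := Real.add_one_le_exp _

lemma measureReal_sum_le_exp_of_nonneg {κ : Type*} [Fintype κ] {Y : κ → Ω → ℝ}
    (hind : iIndepFun Y P) (hY : ∀ i, MemLp (Y i) 2 P) (hY0 : ∀ i ω, 0 ≤ Y i ω) {m s : ℝ}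
    (hm : 0 ≤ m) (hs : 0 < s) (hmean : ∀ i, m ≤ ∫ ω, Y i ω ∂P) (hsq : ∀ i, ∫ ω, Y i ω ^ 2 ∂P ≤ s) :
    P.real {ω | ∑ i, Y i ω ≤ Fintype.card κ * (m / 2)} ≤
      Real.exp (-(Fintype.card κ * (m ^ 2 / (8 * s)))) := by
  set c := m / (2 * s) with hc
  have hc0 : 0 ≤ c := by positivity
  have hmgf : mgf (∑ i, Y i) P (-c) ≤ Real.exp (c ^ 2 / 2 * s - c * m) ^ Fintype.card κ := by
    rw [hind.mgf_sum₀ fun i => (hY i).aemeasurable, ← card_univ, ← prod_const]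
    refine prod_le_prod (fun _ _ => mgf_nonneg) fun i _ =>
      (mgf_neg_le_exp (hY i) (hY0 i) hc0).trans ?_
    gcongr
    exacts [hsq i, hmean i]
  have hchernoff := measure_le_le_exp_mul_mgf (μ := P) (X := ∑ i, Y i)
    (Fintype.card κ * (m / 2)) (neg_nonpos.2 hc0)
    (integrable_exp_neg_mul (Finset.aemeasurable_sum _ fun i _ => (hY i).aemeasurable)
      (fun ω => by simpa only [Finset.sum_apply] using sum_nonneg fun i _ => hY0 i ω) hc0)
  simp only [Finset.sum_apply] at hchernoff
  refine hchernoff.trans ((mul_le_mul_of_nonneg_left hmgf (Real.exp_pos _).le).trans_eq ?_)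
  rw [← Real.exp_nat_mul, ← Real.exp_add, hc]
  congr 1
  field_simp
  ring

end LowerTail

section Truncation

variable {E : Type*} [NormedAddCommGroup E]

/-- The truncation of a vector at norm `r`: vectors outside the closed ball are replaced by `0`, so
that a heavy-tailed sample becomes bounded without increasing any `⟪u, x⟫ ^ 2`. -/
noncomputable def normTruncation (r : ℝ) : E → E :=
  (closedBall 0 r).indicator id

lemma norm_normTruncation_le {r : ℝ} (hr : 0 ≤ r) (x : E) : ‖normTruncation r x‖ ≤ r := by
  by_cases hx : x ∈ closedBall (0 : E) r
  · simpa only [normTruncation, Set.indicator_of_mem hx, id] using mem_closedBall_zero_iff.1 hx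
  · simpa only [normTruncation, Set.indicator_of_notMem hx, norm_zero] using hr

lemma measurable_normTruncation [MeasurableSpace E] [OpensMeasurableSpace E] (r : ℝ) :
    Measurable (normTruncation r : E → E) :=
  measurable_id.indicator isClosed_closedBall.measurableSet

variable [InnerProductSpace ℝ E]

lemma measurable_inner_normTruncation_sq [MeasurableSpace E] [OpensMeasurableSpace E] (r : ℝ)
    (u : E) : Measurable fun x : E => ⟪u, normTruncation r x⟫ ^ 2 :=
  ((innerSL ℝ u).continuous.measurable.comp (measurable_normTruncation r)).pow_const 2

lemma inner_normTruncation_sq_le (r : ℝ) (u x : E) : ⟪u, normTruncation r x⟫ ^ 2 ≤ ⟪u, x⟫ ^ 2 := by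
  by_cases hx : x ∈ closedBall (0 : E) r
  · simp only [normTruncation, Set.indicator_of_mem hx, id, le_refl]
  · simpa only [normTruncation, Set.indicator_of_notMem hx, inner_zero_right, ne_eq,
      OfNat.ofNat_ne_zero, not_false_eq_true, zero_pow] using sq_nonneg _

lemma le_inner_normTruncation_sq {r a : ℝ} (hr : 0 < r) (ha : 0 < a) (u x : E) :
    ⟪u, x⟫ ^ 2 - ⟪u, x⟫ ^ 4 / (4 * a) - a * ‖x‖ ^ 2 / r ^ 2 ≤ ⟪u, normTruncation r x⟫ ^ 2 := by
  by_cases hx : x ∈ closedBall (0 : E) r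
  · simp only [normTruncation, Set.indicator_of_mem hx, id]
    have h4 : 0 ≤ ⟪u, x⟫ ^ 4 / (4 * a) := by positivity
    have h2 : 0 ≤ a * ‖x‖ ^ 2 / r ^ 2 := by positivity
    linarith
  · have hrx : r ^ 2 ≤ ‖x‖ ^ 2 := by
      rw [mem_closedBall_zero_iff, not_le] at hx
      gcongr
    have hmarkov : a ≤ a * ‖x‖ ^ 2 / r ^ 2 := by
      rw [le_div_iff₀ (by positivity)]
      gcongr
    have hamgm : ⟪u, x⟫ ^ 2 ≤ ⟪u, x⟫ ^ 4 / (4 * a) + a := by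
      rw [← sub_nonneg]
      calc 0 ≤ (⟪u, x⟫ ^ 2 - 2 * a) ^ 2 / (4 * a) := by positivity
        _ = _ := by field_simp; ring
    simp only [normTruncation, Set.indicator_of_notMem hx, inner_zero_right]
    linarith

end Truncation

section Isotropic

variable {E : Type*} [NormedAddCommGroup E] [InnerProductSpace ℝ E] [MeasurableSpace E]
  {Ω : Type*} [MeasurableSpace Ω] {P : Measure Ω} {θ : ℝ} {x : Ω → E}

/-- A random vector is isotropic with `L₄`–`L₂` constant `θ` if all its linear functionals `⟪u, x⟫`
have second moment `‖u‖ ^ 2` and fourth moment at most `θ ^ 4 * ‖u‖ ^ 4`. -/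
structure IsIsotropicL4 (θ : ℝ) (x : Ω → E) (P : Measure Ω) : Prop where
  aemeasurable : AEMeasurable x P
  memLp_inner : ∀ u : E, MemLp (fun ω => ⟪u, x ω⟫) 4 P
  integral_inner_sq : ∀ u : E, ∫ ω, ⟪u, x ω⟫ ^ 2 ∂P = ‖u‖ ^ 2
  integral_inner_pow_four_le : ∀ u : E, ∫ ω, ⟪u, x ω⟫ ^ 4 ∂P ≤ θ ^ 4 * ‖u‖ ^ 4

lemma integrable_pow_four {f : Ω → ℝ} (hf : MemLp f 4 P) : Integrable (fun ω => f ω ^ 4) P :=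
  (hf.integrable_norm_pow (p := 4) four_ne_zero).congr
    (.of_forall fun ω => by simp only [Real.norm_eq_abs, Even.pow_abs (show Even 4 by decide)])

lemma memLp_two_sq {f : Ω → ℝ} (hf : MemLp f 4 P) : MemLp (fun ω => f ω ^ 2) 2 P := by
  refine (memLp_two_iff_integrable_sq (hf.aestronglyMeasurable.pow 2)).2 ?_
  simpa only [Pi.pow_apply, ← pow_mul] using integrable_pow_four hf

namespace IsIsotropicL4

lemma integrable_inner_sq [IsFiniteMeasure P] (hx : IsIsotropicL4 θ x P) (u : E) :
    Integrable (fun ω => ⟪u, x ω⟫ ^ 2) P :=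
  ((hx.memLp_inner u).mono_exponent (by norm_num)).integrable_sq

lemma integrable_norm_sq [IsFiniteMeasure P] [FiniteDimensional ℝ E] (hx : IsIsotropicL4 θ x P) :
    Integrable (fun ω => ‖x ω‖ ^ 2) P := by
  simp only [← (stdOrthonormalBasis ℝ E).sum_sq_inner_right]
  exact integrable_finsetSum _ fun k _ => hx.integrable_inner_sq _

lemma integral_norm_sq [IsFiniteMeasure P] [FiniteDimensional ℝ E] (hx : IsIsotropicL4 θ x P) :
    ∫ ω, ‖x ω‖ ^ 2 ∂P = Module.finrank ℝ E := by
  simp only [← (stdOrthonormalBasis ℝ E).sum_sq_inner_right]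
  rw [integral_finsetSum _ fun k _ => hx.integrable_inner_sq _]
  simp only [hx.integral_inner_sq, OrthonormalBasis.norm_eq_one, one_pow, sum_const, card_univ,
    Fintype.card_fin, nsmul_eq_mul, mul_one]

variable [OpensMeasurableSpace E]

lemma memLp_inner_normTruncation_sq (hx : IsIsotropicL4 θ x P) (r : ℝ) (u : E) :
    MemLp (fun ω => ⟪u, normTruncation r (x ω)⟫ ^ 2) 2 P := by
  have hmeas := (measurable_inner_normTruncation_sq r u).comp_aemeasurable hx.aemeasurable
  refine (memLp_two_sq (hx.memLp_inner u)).mono hmeas.aestronglyMeasurable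
    (.of_forall fun ω => ?_)
  simpa only [Real.norm_of_nonneg (sq_nonneg _)] using inner_normTruncation_sq_le r u (x ω)

lemma integral_inner_normTruncation_sq_sq_le (hx : IsIsotropicL4 θ x P) (r : ℝ) (u : E) :
    ∫ ω, (⟪u, normTruncation r (x ω)⟫ ^ 2) ^ 2 ∂P ≤ θ ^ 4 * ‖u‖ ^ 4 := by
  refine (integral_mono (hx.memLp_inner_normTruncation_sq r u).integrable_sq
    (integrable_pow_four (hx.memLp_inner u)) fun ω => ?_).trans (hx.integral_inner_pow_four_le u)
  calc (⟪u, normTruncation r (x ω)⟫ ^ 2) ^ 2 ≤ (⟪u, x ω⟫ ^ 2) ^ 2 :=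
        pow_le_pow_left₀ (sq_nonneg _) (inner_normTruncation_sq_le r u (x ω)) 2
    _ = ⟪u, x ω⟫ ^ 4 := by ring

lemma half_norm_sq_le_integral_inner_normTruncation_sq [IsFiniteMeasure P]
    [FiniteDimensional ℝ E] (hx : IsIsotropicL4 θ x P) (hθ : 0 < θ)
    {r : ℝ} (hr : 0 < r) (hrd : 4 * θ ^ 4 * Module.finrank ℝ E ≤ r ^ 2) {u : E} (hu : u ≠ 0) :
    ‖u‖ ^ 2 / 2 ≤ ∫ ω, ⟪u, normTruncation r (x ω)⟫ ^ 2 ∂P := by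
  set a := θ ^ 4 * ‖u‖ ^ 2
  have ha : 0 < a := by positivity
  have hint2 := hx.integrable_inner_sq u
  have hint4 := (integrable_pow_four (hx.memLp_inner u)).div_const (4 * a)
  have hint24 : Integrable (fun ω => ⟪u, x ω⟫ ^ 2 - ⟪u, x ω⟫ ^ 4 / (4 * a)) P := hint2.sub hint4
  have hintn := (hx.integrable_norm_sq.const_mul a).div_const (r ^ 2)
  have hfourth : (∫ ω, ⟪u, x ω⟫ ^ 4 ∂P) / (4 * a) ≤ ‖u‖ ^ 2 / 4 := by
    rw [div_le_iff₀ (by positivity)]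
    exact (hx.integral_inner_pow_four_le u).trans_eq (by ring)
  have htail : a * Module.finrank ℝ E / r ^ 2 ≤ ‖u‖ ^ 2 / 4 := by
    rw [div_le_iff₀ (by positivity)]
    calc a * Module.finrank ℝ E = ‖u‖ ^ 2 / 4 * (4 * θ ^ 4 * Module.finrank ℝ E) := by ring
      _ ≤ ‖u‖ ^ 2 / 4 * r ^ 2 := by gcongr
  calc ‖u‖ ^ 2 / 2
      ≤ ‖u‖ ^ 2 - (∫ ω, ⟪u, x ω⟫ ^ 4 ∂P) / (4 * a) - a * Module.finrank ℝ E / r ^ 2 := by linarith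
    _ = ∫ ω, (⟪u, x ω⟫ ^ 2 - ⟪u, x ω⟫ ^ 4 / (4 * a) - a * ‖x ω‖ ^ 2 / r ^ 2) ∂P := by
        rw [integral_sub hint24 hintn, integral_sub hint2 hint4, integral_div,
          integral_div, integral_const_mul, hx.integral_norm_sq, hx.integral_inner_sq]
    _ ≤ ∫ ω, ⟪u, normTruncation r (x ω)⟫ ^ 2 ∂P :=
        integral_mono (hint24.sub hintn)
          ((hx.memLp_inner_normTruncation_sq r u).integrable one_le_two)
          fun ω => le_inner_normTruncation_sq hr ha u (x ω)

end IsIsotropicL4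

lemma measureReal_sum_inner_normTruncation_sq_lt_le [IsProbabilityMeasure P]
    [OpensMeasurableSpace E] [FiniteDimensional ℝ E] {κ : Type*} [Fintype κ] {x : κ → Ω → E}
    (hind : iIndepFun x P) (hx : ∀ i, IsIsotropicL4 θ (x i) P) (hθ : 0 < θ) {r : ℝ} (hr : 0 < r)
    (hrd : 4 * θ ^ 4 * Module.finrank ℝ E ≤ r ^ 2) (u : E) :
    P.real {ω | ∑ i, ⟪u, normTruncation r (x i ω)⟫ ^ 2 < Fintype.card κ / 4 * ‖u‖ ^ 2} ≤
      Real.exp (-(Fintype.card κ / (32 * θ ^ 4))) := by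
  rcases eq_or_ne u 0 with rfl | hu
  · simp [Real.exp_nonneg]
  · have htail := measureReal_sum_le_exp_of_nonneg (m := ‖u‖ ^ 2 / 2) (s := θ ^ 4 * ‖u‖ ^ 4)
      (hind.comp _ fun _ => measurable_inner_normTruncation_sq r u)
      (fun i => (hx i).memLp_inner_normTruncation_sq r u) (fun _ _ => sq_nonneg _)
      (by positivity) (by positivity)
      (fun i => (hx i).half_norm_sq_le_integral_inner_normTruncation_sq hθ hr hrd hu)
      (fun i => (hx i).integral_inner_normTruncation_sq_sq_le r u)
    have hlevel : Fintype.card κ * (‖u‖ ^ 2 / 2 / 2) = Fintype.card κ / 4 * ‖u‖ ^ 2 := by ring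
    rw [hlevel] at htail
    refine (measureReal_mono fun ω hω => ?_).trans (htail.trans_eq ?_)
    · exact le_of_lt (Set.mem_ofPred_eq ▸ hω)
    · congr 1
      field_simp
      ring

end Isotropic

section LowerIsometry

variable {E ι κ : Type*} [NormedAddCommGroup E] [InnerProductSpace ℝ E] [Fintype ι] [Fintype κ]

/-- The point with coordinates `h * m k` in the orthonormal basis `b`, that is, the point with label
`m` of the lattice of mesh `h`. -/
noncomputable def latticePoint (b : OrthonormalBasis ι ℝ E) (h : ℝ) (m : ι → ℤ) : E :=
  ∑ k, (h * m k) • b k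

lemma inner_latticePoint (b : OrthonormalBasis ι ℝ E) (h : ℝ) (m : ι → ℤ) (k : ι) :
    ⟪b k, latticePoint b h m⟫ = h * m k :=
  b.orthonormal.inner_right_fintype (fun k => h * (m k : ℝ)) k

lemma norm_latticePoint_sq (b : OrthonormalBasis ι ℝ E) (h : ℝ) (m : ι → ℤ) :
    ‖latticePoint b h m‖ ^ 2 = h ^ 2 * ∑ k, (m k : ℝ) ^ 2 := by
  simp only [← b.sum_sq_inner_right, inner_latticePoint, mul_pow, mul_sum]

/-- The quadratic form `u ↦ ∑ i, ⟪u, y i⟫ ^ 2 - a * ‖u‖ ^ 2`, whose nonnegativity is a lower bound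
on the empirical covariance of the sample `y`. -/
noncomputable def excessCovariance (y : κ → E) (a : ℝ) : QuadraticForm ℝ E :=
  ∑ i, QuadraticMap.sq.comp (innerₗ E (y i)) -
    a • LinearMap.BilinMap.toQuadraticMap (innerₗ E : LinearMap.BilinForm ℝ E)

lemma excessCovariance_apply (y : κ → E) (a : ℝ) (u : E) :
    excessCovariance y a u = ∑ i, ⟪u, y i⟫ ^ 2 - a * ‖u‖ ^ 2 := by
  simp [excessCovariance, _root_.sum_apply, real_inner_comm, sq]

lemma exists_latticePoint_excessCovariance_le (b : OrthonormalBasis ι ℝ E) (y : κ → E) {a h : ℝ}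
    (ha : 0 ≤ a) (hh : 0 < h) (v : E) :
    ∃ m : ι → ℤ, (∀ k, |⟪b k, latticePoint b h m - v⟫| ≤ h) ∧
      excessCovariance y a (latticePoint b h m) ≤
        excessCovariance y a v + h ^ 2 / 4 * ∑ i, ‖y i‖ ^ 2 := by
  have hdiag : ∀ k, excessCovariance y a (b.toBasis k) ≤ ∑ i, ⟪b k, y i⟫ ^ 2 := fun k => by
    rw [excessCovariance_apply, b.coe_toBasis]
    exact sub_le_self _ (by positivity)
  obtain ⟨u, hround, -, hle⟩ := exists_round_coords_quadraticForm_le (excessCovariance y a)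
    b.toBasis hdiag (fun _ => by positivity) hh v univ
  choose m hm using fun k => (hround k (mem_univ k)).1
  have hu : latticePoint b h m = u := by
    rw [latticePoint, ← b.toBasis.sum_repr u]
    simp only [hm, b.coe_toBasis]
  have htrace : ∑ k, ∑ i, ⟪b k, y i⟫ ^ 2 = ∑ i, ‖y i‖ ^ 2 := by
    rw [sum_comm]
    simp only [b.sum_sq_inner_right]
  refine ⟨m, fun k => ?_, ?_⟩
  · rw [hu, inner_sub_right, ← b.repr_apply_apply, ← b.repr_apply_apply]
    exact (hround k (mem_univ k)).2
  · rwa [hu, ← htrace]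

lemma norm_sq_le_card_mul_of_abs_inner_le (b : OrthonormalBasis ι ℝ E) {h : ℝ} {w : E}
    (hw : ∀ k, |⟪b k, w⟫| ≤ h) : ‖w‖ ^ 2 ≤ Fintype.card ι * h ^ 2 := by
  rw [← b.sum_sq_inner_right, ← nsmul_eq_mul]
  exact sum_le_card_nsmul _ _ _ fun k _ => sq_le_sq' (neg_le_of_abs_le (hw k)) (le_of_abs_le (hw k))

/-- A lower bound for the truncated sample at the lattice points of norm at most `2` spreads to the
unit sphere: rounding a unit vector to the lattice increases the truncated quadratic form by at most
`h ^ 2 / 4 * (card κ * r ^ 2) ≤ card κ / 8`. -/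
lemma le_sum_inner_sq_of_latticePoint_of_norm_eq_one (b : OrthonormalBasis ι ℝ E) (x : κ → E)
    {r h : ℝ} (hr : 0 ≤ r) (hh : 0 < h) (hcard : Fintype.card ι * h ^ 2 ≤ 1)
    (hrh : h ^ 2 * r ^ 2 ≤ 1 / 2)
    (hlattice : ∀ m : ι → ℤ, ‖latticePoint b h m‖ ≤ 2 →
      Fintype.card κ / 4 * ‖latticePoint b h m‖ ^ 2 ≤
        ∑ i, ⟪latticePoint b h m, normTruncation r (x i)⟫ ^ 2) {v : E} (hv : ‖v‖ = 1) :
    (Fintype.card κ / 8 : ℝ) ≤ ∑ i, ⟪v, x i⟫ ^ 2 := by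
  obtain ⟨m, hround, hle⟩ := exists_latticePoint_excessCovariance_le b
    (fun i => normTruncation r (x i)) (a := Fintype.card κ / 4) (by positivity) hh v
  have hdist : ‖latticePoint b h m - v‖ ≤ 1 :=
    (sq_le_one_iff₀ (norm_nonneg _)).1 ((norm_sq_le_card_mul_of_abs_inner_le b hround).trans hcard)
  have hnorm : ‖latticePoint b h m‖ ≤ 2 := by
    linarith [norm_le_norm_add_norm_sub' (latticePoint b h m) v]
  have hincr : h ^ 2 / 4 * ∑ i, ‖normTruncation r (x i)‖ ^ 2 ≤ Fintype.card κ / 8 :=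
    calc h ^ 2 / 4 * ∑ i, ‖normTruncation r (x i)‖ ^ 2
        ≤ h ^ 2 / 4 * ∑ _i : κ, r ^ 2 := by
          gcongr with i
          exact norm_normTruncation_le hr (x i)
      _ = h ^ 2 * r ^ 2 * (Fintype.card κ / 4) := by
          rw [sum_const, card_univ, nsmul_eq_mul]
          ring
      _ ≤ 1 / 2 * (Fintype.card κ / 4) := by gcongr
      _ = Fintype.card κ / 8 := by ring
  rw [excessCovariance_apply, excessCovariance_apply, hv] at hle
  have hlow := hlattice m hnorm
  calc (Fintype.card κ / 8 : ℝ) ≤ ∑ i, ⟪v, normTruncation r (x i)⟫ ^ 2 := by linarith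
    _ ≤ ∑ i, ⟪v, x i⟫ ^ 2 := sum_le_sum fun i _ => inner_normTruncation_sq_le r v (x i)

lemma mul_norm_sq_le_sum_inner_sq_of_norm_eq_one {x : κ → E} {c : ℝ}
    (hx : ∀ v : E, ‖v‖ = 1 → c ≤ ∑ i, ⟪v, x i⟫ ^ 2) (t : E) :
    c * ‖t‖ ^ 2 ≤ ∑ i, ⟪t, x i⟫ ^ 2 := by
  rcases eq_or_ne t 0 with rfl | ht
  · simp
  · have hunit := hx (‖t‖⁻¹ • t) (norm_smul_inv_norm ht)
    simp only [real_inner_smul_left, mul_pow, ← mul_sum] at hunit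
    rwa [inv_pow, le_inv_mul_iff₀ (by positivity), mul_comm] at hunit

variable [MeasurableSpace E] [OpensMeasurableSpace E] [FiniteDimensional ℝ E] {Ω : Type*}
  [MeasurableSpace Ω] {P : Measure Ω} [IsProbabilityMeasure P] {θ : ℝ} {x : κ → Ω → E}

lemma measureReal_exists_sum_inner_sq_lt_le_of_mesh (hind : iIndepFun x P)
    (hx : ∀ i, IsIsotropicL4 θ (x i) P) (hθ : 0 < θ) {r h : ℝ} (hr : 0 < r) (hh : 0 < h)
    (hrd : 4 * θ ^ 4 * Module.finrank ℝ E ≤ r ^ 2) (hhd : Module.finrank ℝ E * h ^ 2 ≤ 1)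
    (hrh : h ^ 2 * r ^ 2 ≤ 1 / 2) :
    P.real {ω | ∃ t : E, ∑ i, ⟪t, x i ω⟫ ^ 2 < Fintype.card κ / 8 * ‖t‖ ^ 2} ≤
      Real.exp (4 / h ^ 2 + 2 * Module.finrank ℝ E - Fintype.card κ / (32 * θ ^ 4)) := by
  set b := stdOrthonormalBasis ℝ E
  obtain ⟨T, hT, hTcard⟩ := exists_finset_sum_sq_le_mem (ι := Fin (Module.finrank ℝ E))
    (R := 4 / h ^ 2) (by positivity)
  rw [Fintype.card_fin] at hTcard
  set bad : E → Set Ω := fun u =>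
    {ω | ∑ i, ⟪u, normTruncation r (x i ω)⟫ ^ 2 < Fintype.card κ / 4 * ‖u‖ ^ 2}
  have hcover : {ω | ∃ t : E, ∑ i, ⟪t, x i ω⟫ ^ 2 < Fintype.card κ / 8 * ‖t‖ ^ 2} ⊆
      ⋃ m ∈ T, bad (latticePoint b h m) := by
    rintro ω ⟨t, ht⟩
    by_contra hω
    simp only [Set.mem_iUnion, not_exists] at hω
    refine ht.not_ge (mul_norm_sq_le_sum_inner_sq_of_norm_eq_one (fun v hv =>
      le_sum_inner_sq_of_latticePoint_of_norm_eq_one b _ hr.le hh (by rwa [Fintype.card_fin]) hrh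
        (fun m hm => not_lt.1 (hω m (hT m ?_))) hv) t)
    rw [le_div_iff₀' (by positivity), ← norm_latticePoint_sq b]
    nlinarith [norm_nonneg (latticePoint b h m)]
  calc P.real {ω | ∃ t : E, ∑ i, ⟪t, x i ω⟫ ^ 2 < Fintype.card κ / 8 * ‖t‖ ^ 2}
      ≤ P.real (⋃ m ∈ T, bad (latticePoint b h m)) := measureReal_mono hcover (measure_ne_top _ _)
    _ ≤ ∑ m ∈ T, P.real (bad (latticePoint b h m)) := measureReal_biUnion_finset_le _ _
    _ ≤ ∑ _m ∈ T, Real.exp (-(Fintype.card κ / (32 * θ ^ 4))) := sum_le_sum fun m _ =>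
        measureReal_sum_inner_normTruncation_sq_lt_le hind hx hθ hr hrd _
    _ ≤ Real.exp (4 / h ^ 2 + 2 * Module.finrank ℝ E) *
          Real.exp (-(Fintype.card κ / (32 * θ ^ 4))) := by
        rw [sum_const, nsmul_eq_mul]
        gcongr
    _ = Real.exp (4 / h ^ 2 + 2 * Module.finrank ℝ E - Fintype.card κ / (32 * θ ^ 4)) := by
        rw [← Real.exp_add, sub_eq_add_neg]

/-- The choice `r² = 4θ⁴ dim E` keeps half of each second moment, and the mesh is then dictated by
`h² r² = 1 / 2`. -/
theorem measureReal_exists_sum_inner_sq_lt_le (hind : iIndepFun x P)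
    (hx : ∀ i, IsIsotropicL4 θ (x i) P) (hθ : 1 ≤ θ)
    (hcard : 2176 * θ ^ 8 * Module.finrank ℝ E ≤ Fintype.card κ) :
    P.real {ω | ∃ t : E, ∑ i, ⟪t, x i ω⟫ ^ 2 < Fintype.card κ / 8 * ‖t‖ ^ 2} ≤
      Real.exp (-(Fintype.card κ / (64 * θ ^ 4))) := by
  rcases subsingleton_or_nontrivial E with hE | hE
  · simp [Subsingleton.elim _ (0 : E), Real.exp_nonneg]
  have hθ4 : 1 ≤ θ ^ 4 := one_le_pow₀ hθ
  have hd : (0 : ℝ) < Module.finrank ℝ E := Nat.cast_pos.2 Module.finrank_pos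
  set D := 4 * θ ^ 4 * Module.finrank ℝ E with hD
  have hD0 : 0 < D := by positivity
  have hr2 : √D ^ 2 = D := Real.sq_sqrt hD0.le
  have hh2 : √(1 / (2 * D)) ^ 2 = 1 / (2 * D) := Real.sq_sqrt (by positivity)
  have htail := measureReal_exists_sum_inner_sq_lt_le_of_mesh hind hx (by positivity)
    (r := √D) (h := √(1 / (2 * D))) (by positivity) (by positivity) hr2.ge
    (by rw [hh2, mul_one_div, div_le_one (by positivity)]; nlinarith)
    (by rw [hh2, hr2]; exact le_of_eq (by field_simp))
  refine htail.trans (Real.exp_le_exp.2 ?_)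
  have hentropy : 34 * θ ^ 4 * Module.finrank ℝ E ≤ Fintype.card κ / (64 * θ ^ 4) := by
    rw [le_div_iff₀ (by positivity)]
    exact (le_of_eq (by ring)).trans hcard
  calc 4 / √(1 / (2 * D)) ^ 2 + 2 * Module.finrank ℝ E - Fintype.card κ / (32 * θ ^ 4)
      = 32 * θ ^ 4 * Module.finrank ℝ E + 2 * Module.finrank ℝ E
          - 2 * (Fintype.card κ / (64 * θ ^ 4)) := by
        rw [hh2, hD]
        field_simp
        ring
    _ ≤ -(Fintype.card κ / (64 * θ ^ 4)) := by nlinarith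

end LowerIsometry

section Noise

variable {Ω : Type*} [MeasurableSpace Ω] {P : Measure Ω}

lemma measureReal_mul_lt_le_one_div [IsProbabilityMeasure P] {S : Ω → ℝ} (hS : Integrable S P)
    (hS0 : ∀ ω, 0 ≤ S ω) {c x : ℝ} (hc : ∫ ω, S ω ∂P ≤ c) (hx : 0 < x) :
    P.real {ω | c * x < S ω} ≤ 1 / x := by
  rcases ((integral_nonneg hS0).trans hc).eq_or_lt with h | h
  · have hzero : S =ᵐ[P] 0 :=
      (integral_eq_zero_iff_of_nonneg hS0 hS).1 (le_antisymm (h ▸ hc) (integral_nonneg hS0))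
    have hnull : P.real {ω | c * x < S ω} = 0 :=
      (measureReal_eq_zero_iff).2 <| measure_mono_null
        (fun ω (hω : c * x < S ω) => ne_of_gt (by rwa [← h, zero_mul] at hω)) (ae_iff.1 hzero)
    rw [hnull]
    positivity
  · have hmarkov := mul_meas_ge_le_integral_of_nonneg (.of_forall hS0) hS (c * x)
    calc P.real {ω | c * x < S ω} ≤ P.real {ω | c * x ≤ S ω} :=
          measureReal_mono fun ω hω => le_of_lt (Set.mem_ofPred_eq ▸ hω)
      _ ≤ c / (c * x) := by
          rw [le_div_iff₀' (by positivity)]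
          exact hmarkov.trans hc
      _ = 1 / x := by field_simp

lemma integral_sum_sq_eq_of_indepFun [IsProbabilityMeasure P] {κ : Type*} [Fintype κ]
    {Z : κ → Ω → ℝ} (hind : Pairwise fun i j => IndepFun (Z i) (Z j) P)
    (hL : ∀ i, MemLp (Z i) 2 P) (hmean : ∀ i, ∫ ω, Z i ω ∂P = 0) :
    ∫ ω, (∑ i, Z i ω) ^ 2 ∂P = ∑ i, ∫ ω, Z i ω ^ 2 ∂P := by
  have hsum : ∑ i, Z i = fun ω => ∑ i, Z i ω := funext fun ω => Finset.sum_apply ω _ _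
  have hvar := IndepFun.variance_sum (s := univ) (fun i _ => hL i) (hind.set_pairwise _)
  have hmean_sum : ∫ ω, ∑ i, Z i ω ∂P = 0 := by
    rw [integral_finsetSum _ fun i _ => (hL i).integrable one_le_two]
    exact sum_eq_zero fun i _ => hmean i
  rw [hsum, variance_of_integral_eq_zero
    (memLp_finsetSum _ fun i _ => hL i).aemeasurable hmean_sum] at hvar
  rw [hvar]
  exact sum_congr rfl fun i _ => variance_of_integral_eq_zero (hL i).aemeasurable (hmean i)

variable {E : Type*} [NormedAddCommGroup E] [InnerProductSpace ℝ E] [FiniteDimensional ℝ E]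
  [MeasurableSpace E] [OpensMeasurableSpace E]

lemma measureReal_lt_norm_sum_sq_le [IsProbabilityMeasure P] {κ : Type*} [Fintype κ]
    {W : κ → Ω → E} (hind : iIndepFun W P) (hL : ∀ i u, MemLp (fun ω => ⟪u, W i ω⟫) 2 P)
    (hmean : ∀ i u, ∫ ω, ⟪u, W i ω⟫ ∂P = 0) {s : ℝ}
    (hs : ∀ i u, ∫ ω, ⟪u, W i ω⟫ ^ 2 ∂P ≤ s * ‖u‖ ^ 2) {x : ℝ} (hx : 0 < x) :
    P.real {ω | Fintype.card κ * Module.finrank ℝ E * s * x < ‖∑ i, W i ω‖ ^ 2} ≤ 1 / x := by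
  set b := stdOrthonormalBasis ℝ E
  have hexpand : ∀ ω, ‖∑ i, W i ω‖ ^ 2 = ∑ k, (∑ i, ⟪b k, W i ω⟫) ^ 2 := fun ω => by
    simp only [← inner_sum, b.sum_sq_inner_right]
  have hint : ∀ k, Integrable (fun ω => (∑ i, ⟪b k, W i ω⟫) ^ 2) P := fun k =>
    (memLp_finsetSum _ fun i _ => hL i (b k)).integrable_sq
  have hcoord : ∀ k, ∫ ω, (∑ i, ⟪b k, W i ω⟫) ^ 2 ∂P ≤ Fintype.card κ * s := fun k => by
    have hindk : iIndepFun (fun i ω => ⟪b k, W i ω⟫) P :=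
      hind.comp (fun _ w => ⟪b k, w⟫) fun _ => (innerSL ℝ (b k)).continuous.measurable
    rw [integral_sum_sq_eq_of_indepFun (fun i j hij => hindk.indepFun hij)
      (fun i => hL i (b k)) fun i => hmean i (b k), ← card_univ, ← nsmul_eq_mul]
    refine sum_le_card_nsmul _ _ _ fun i _ => (hs i (b k)).trans_eq ?_
    rw [b.norm_eq_one, one_pow, mul_one]
  simp only [hexpand]
  refine measureReal_mul_lt_le_one_div (integrable_finsetSum _ fun k _ => hint k)
    (fun ω => sum_nonneg fun k _ => sq_nonneg _) ?_ hx
  rw [integral_finsetSum _ fun k _ => hint k]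
  calc ∑ k, ∫ ω, (∑ i, ⟪b k, W i ω⟫) ^ 2 ∂P
      ≤ ∑ _k : Fin (Module.finrank ℝ E), Fintype.card κ * s := sum_le_sum fun k _ => hcoord k
    _ = Fintype.card κ * Module.finrank ℝ E * s := by
        rw [sum_const, card_univ, Fintype.card_fin, nsmul_eq_mul]
        ring

end Noise

section HolderFour

variable {Ω : Type*} [MeasurableSpace Ω] {P : Measure Ω} {f g : Ω → ℝ}

lemma memLp_two_mul (hf : MemLp f 4 P) (hg : MemLp g 4 P) : MemLp (fun ω => f ω * g ω) 2 P := by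
  refine (memLp_two_iff_integrable_sq (hf.aestronglyMeasurable.mul hg.aestronglyMeasurable)).2 ?_
  simp only [Pi.mul_apply, mul_pow]
  exact (memLp_two_sq hf).integrable_mul (memLp_two_sq hg)

lemma integral_mul_sq_le_sqrt_mul_sqrt (hf : MemLp f 4 P) (hg : MemLp g 4 P) :
    ∫ ω, (f ω * g ω) ^ 2 ∂P ≤ √(∫ ω, f ω ^ 4 ∂P) * √(∫ ω, g ω ^ 4 ∂P) := by
  have hholder := integral_mul_le_Lp_mul_Lq_of_nonneg (μ := P) Real.HolderConjugate.two_two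
    (.of_forall fun ω => sq_nonneg (f ω)) (.of_forall fun ω => sq_nonneg (g ω))
    (by simpa using memLp_two_sq hf) (by simpa using memLp_two_sq hg)
  simpa only [mul_pow, Real.sqrt_eq_rpow, Real.rpow_two, ← pow_mul] using hholder

end HolderFour

section Transfer

variable {𝒳 Ω : Type*} [MeasurableSpace 𝒳] [MeasurableSpace Ω] {μ : Measure 𝒳} {P : Measure Ω}
  {X : Ω → 𝒳}

lemma toReal_eLpNorm_pow {f : 𝒳 → ℝ} (hf : AEStronglyMeasurable f μ) {n : ℕ} (hn : n ≠ 0)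
    (heven : Even n) : (eLpNorm f n μ).toReal ^ n = ∫ x, f x ^ n ∂μ := by
  rw [toReal_eLpNorm hf, lpNorm_eq_integral_norm_rpow_toReal (by exact_mod_cast hn)
    (ENNReal.natCast_ne_top n) hf]
  simp only [ENNReal.toReal_natCast, Real.rpow_natCast, Real.norm_eq_abs, heven.pow_abs]
  exact Real.rpow_inv_natCast_pow (integral_nonneg fun x => heven.pow_nonneg _) hn

lemma eLpNorm_eq_zero_of_le_ofReal_mul [IsProbabilityMeasure μ] {p q : ENNReal} (hpq : p ≤ q)
    {f : 𝒳 → ℝ} (hf : MemLp f p μ) {θ : ℝ} (hθ : θ < 1)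
    (h : eLpNorm f q μ ≤ ENNReal.ofReal θ * eLpNorm f p μ) : eLpNorm f p μ = 0 := by
  by_contra h0
  refine (ENNReal.ofReal_lt_one.2 hθ).not_ge ?_
  rw [← ENNReal.mul_le_mul_iff_left h0 hf.eLpNorm_ne_top, one_mul]
  exact (eLpNorm_le_eLpNorm_of_exponent_le hpq hf.aestronglyMeasurable).trans h

lemma memLp_comp_of_hasLaw (hX : HasLaw X μ P) {f : 𝒳 → ℝ} {p : ENNReal} (hf : MemLp f p μ) :
    MemLp (fun ω => f (X ω)) p P :=
  (memLp_map_measure_iff (hX.map_eq.symm ▸ hf.aestronglyMeasurable) hX.aemeasurable).1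
    (hX.map_eq.symm ▸ hf)

lemma ae_comp_of_hasLaw (hX : HasLaw X μ P) {p : 𝒳 → Prop} (hp : ∀ᵐ x ∂μ, p x) :
    ∀ᵐ ω ∂P, p (X ω) :=
  ae_of_ae_map hX.aemeasurable (hX.map_eq.symm ▸ hp)

lemma IsIsotropicL4.comp_hasLaw {E : Type*} [NormedAddCommGroup E] [InnerProductSpace ℝ E]
    [MeasurableSpace E] {θ : ℝ} {φ : 𝒳 → E} (hφ : IsIsotropicL4 θ φ μ) (hX : HasLaw X μ P) :
    IsIsotropicL4 θ (fun ω => φ (X ω)) P where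
  aemeasurable := (hX.map_eq.symm ▸ hφ.aemeasurable : AEMeasurable φ (P.map X)).comp_aemeasurable
    hX.aemeasurable
  memLp_inner u := memLp_comp_of_hasLaw hX (hφ.memLp_inner u)
  integral_inner_sq u := by
    rw [← hφ.integral_inner_sq u]
    exact hX.integral_comp (f := fun x => ⟪u, φ x⟫ ^ 2)
      ((hφ.memLp_inner u).aestronglyMeasurable.pow 2)
  integral_inner_pow_four_le u := by
    refine le_of_eq_of_le ?_ (hφ.integral_inner_pow_four_le u)
    exact hX.integral_comp (f := fun x => ⟪u, φ x⟫ ^ 4)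
      ((hφ.memLp_inner u).aestronglyMeasurable.pow 4)

end Transfer

section Coordinates

variable {𝒳 : Type*} [MeasurableSpace 𝒳] {μ : Measure 𝒳} {S : Submodule ℝ (𝒳 → ℝ)} {d : ℕ}

/-- Coordinates of the functions of `S` in an orthonormal system of `L²(μ)`: the `k`-th entry of
`feature x` is the value at `x` of the `k`-th function of the system, and `coord f` are the
coordinates of `f`. Functions that agree almost everywhere share their coordinates, so the expansion
`f x = ⟪coord f, feature x⟫` holds off a null set, which is required to be the same for all `f`. -/
structure OrthonormalCoordinates (μ : Measure 𝒳) (S : Submodule ℝ (𝒳 → ℝ)) (d : ℕ) where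
  feature : 𝒳 → EuclideanSpace ℝ (Fin d)
  coord : S →ₗ[ℝ] EuclideanSpace ℝ (Fin d)
  measurable_feature : Measurable feature
  coord_surjective : Function.Surjective coord
  norm_coord : ∀ f : S, ‖coord f‖ = (eLpNorm (f : 𝒳 → ℝ) 2 μ).toReal
  ae_eq_inner : ∀ᵐ x ∂μ, ∀ f : S, (f : 𝒳 → ℝ) x = ⟪coord f, feature x⟫

/-- The map sending a square-integrable function to its class in `L²(μ)`. -/
noncomputable def toLpLinearMap (hS : ∀ f ∈ S, MemLp f 2 μ) : S →ₗ[ℝ] Lp ℝ 2 μ where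
  toFun f := (hS f f.2).toLp f
  map_add' f g := MemLp.toLp_add (hS f f.2) (hS g g.2)
  map_smul' c f := MemLp.toLp_const_smul c (hS f f.2)

lemma ae_forall_eq_inner_of_forall_ae {E : Type*} [NormedAddCommGroup E] [InnerProductSpace ℝ E]
    [FiniteDimensional ℝ S] {coord : S →ₗ[ℝ] E} {φ : 𝒳 → E}
    (h : ∀ f : S, (f : 𝒳 → ℝ) =ᵐ[μ] fun x => ⟪coord f, φ x⟫) :
    ∀ᵐ x ∂μ, ∀ f : S, (f : 𝒳 → ℝ) x = ⟪coord f, φ x⟫ := by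
  let B := Module.finBasis ℝ S
  filter_upwards [ae_all_iff.2 fun i => h (B i)] with x hx f
  have hext : LinearMap.proj x ∘ₗ S.subtype = innerₗ E (φ x) ∘ₗ coord :=
    B.ext fun i => (hx i).trans (real_inner_comm _ _)
  exact (LinearMap.congr_fun hext f).trans (real_inner_comm _ _)

lemma coeFn_ae_eq_inner_repr {V : Submodule ℝ (Lp ℝ 2 μ)} (b : OrthonormalBasis (Fin d) ℝ V)
    (g : V) : ((g : Lp ℝ 2 μ) : 𝒳 → ℝ) =ᵐ[μ]
      fun x => ⟪b.repr g, WithLp.toLp 2 fun k => ((b k : Lp ℝ 2 μ) : 𝒳 → ℝ) x⟫ := by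
  have hg : (g : Lp ℝ 2 μ) = ∑ k, b.repr g k • (b k : Lp ℝ 2 μ) := by
    simpa using congrArg Subtype.val (b.sum_repr g).symm
  have hsmul : ∀ᵐ x ∂μ, ∀ k, (b.repr g k • (b k : Lp ℝ 2 μ) : Lp ℝ 2 μ) x =
      b.repr g k * (b k : Lp ℝ 2 μ) x := ae_all_iff.2 fun k => Lp.coeFn_smul _ _
  filter_upwards [Lp.coeFn_finsetSum univ fun k => b.repr g k • (b k : Lp ℝ 2 μ), hsmul]
    with x hsum hx
  rw [← hg] at hsum
  simp only [hsum, Finset.sum_apply, hx, PiLp.inner_apply, RCLike.inner_apply, conj_trivial,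
    mul_comm]

lemma exists_orthonormalCoordinates [FiniteDimensional ℝ S] (hS : ∀ f ∈ S, MemLp f 2 μ) :
    ∃ d ≤ Module.finrank ℝ S, Nonempty (OrthonormalCoordinates μ S d) := by
  set T := toLpLinearMap hS
  set b := stdOrthonormalBasis ℝ (LinearMap.range T)
  refine ⟨_, LinearMap.finrank_range_le T,
    ⟨{ feature x := WithLp.toLp 2 fun k => ((b k : Lp ℝ 2 μ) : 𝒳 → ℝ) x
       coord := b.repr.toLinearEquiv.toLinearMap ∘ₗ T.rangeRestrict
       measurable_feature := (WithLp.measurable_toLp 2 _).comp <|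
         measurable_pi_lambda _ fun k => (Lp.stronglyMeasurable _).measurable
       coord_surjective := b.repr.surjective.comp T.surjective_rangeRestrict
       norm_coord f := (b.repr.norm_map _).trans (Lp.norm_toLp _ (hS f f.2))
       ae_eq_inner := ae_forall_eq_inner_of_forall_ae fun f => ?_ }⟩⟩
  exact (hS f f.2).coeFn_toLp.symm.trans (coeFn_ae_eq_inner_repr b (T.rangeRestrict f))

lemma OrthonormalCoordinates.isIsotropicL4_feature (C : OrthonormalCoordinates μ S d)
    (hS : ∀ f ∈ S, MemLp f 2 μ) {θ : ℝ} (hθ : 0 ≤ θ)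
    (hnorm : ∀ f ∈ S, eLpNorm f 4 μ ≤ ENNReal.ofReal θ * eLpNorm f 2 μ) :
    IsIsotropicL4 θ C.feature μ := by
  have hpow : ∀ (n : ℕ) (f : S),
      ∫ x, ⟪C.coord f, C.feature x⟫ ^ n ∂μ = ∫ x, (f : 𝒳 → ℝ) x ^ n ∂μ := fun n f =>
    integral_congr_ae (C.ae_eq_inner.mono fun x hx => by simp only [hx f])
  have hfinite : ∀ f : S, ENNReal.ofReal θ * eLpNorm (f : 𝒳 → ℝ) 2 μ ≠ ⊤ := fun f =>
    ENNReal.mul_ne_top ENNReal.ofReal_ne_top (hS f f.2).eLpNorm_ne_top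
  refine ⟨C.measurable_feature.aemeasurable, fun u => ?_, fun u => ?_, fun u => ?_⟩ <;>
    obtain ⟨f, rfl⟩ := C.coord_surjective u
  · exact (memLp_congr_ae (C.ae_eq_inner.mono fun x hx => hx f)).1
      ⟨(hS f f.2).aestronglyMeasurable, (hnorm f f.2).trans_lt (hfinite f).lt_top⟩
  · rw [hpow, C.norm_coord]
    exact (toReal_eLpNorm_pow (hS f f.2).aestronglyMeasurable two_ne_zero even_two).symm
  · have hbound := ENNReal.toReal_mono (hfinite f) (hnorm f f.2)
    rw [ENNReal.toReal_mul, ENNReal.toReal_ofReal hθ] at hbound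
    rw [hpow, C.norm_coord, ← mul_pow]
    calc ∫ x, (f : 𝒳 → ℝ) x ^ 4 ∂μ = (eLpNorm (f : 𝒳 → ℝ) 4 μ).toReal ^ 4 :=
          (toReal_eLpNorm_pow (hS f f.2).aestronglyMeasurable four_ne_zero (by decide)).symm
      _ ≤ (θ * (eLpNorm (f : 𝒳 → ℝ) 2 μ).toReal) ^ 4 :=
          pow_le_pow_left₀ ENNReal.toReal_nonneg hbound 4

end Coordinates

section Risk

variable {𝒳 Ω₀ : Type*} [MeasurableSpace Ω₀] {P₀ : Measure Ω₀} {X : Ω₀ → 𝒳} {Y : Ω₀ → ℝ} {M : ℕ}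
  {F : Fin M → 𝒳 → ℝ} {fstar : 𝒳 → ℝ}

lemma IsERM.sum_sub_sq_le {N : ℕ} (hN : 0 < N) {x : Fin N → 𝒳} {y : Fin N → ℝ}
    {f g : 𝒳 → ℝ} (hf : IsERM x y F f) (hg : g ∈ dictSpan F) :
    ∑ i, (f - g) (x i) ^ 2 ≤ 2 * ∑ i, (y i - g (x i)) * (f - g) (x i) := by
  have hmin : ∑ i, (y i - f (x i)) ^ 2 ≤ ∑ i, (y i - g (x i)) ^ 2 :=
    le_of_mul_le_mul_left (hf.2 g hg) (by positivity)
  have hexpand : ∑ i, (y i - f (x i)) ^ 2 = ∑ i, (y i - g (x i)) ^ 2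
      - 2 * ∑ i, (y i - g (x i)) * (f - g) (x i) + ∑ i, (f - g) (x i) ^ 2 := by
    rw [mul_sum, ← sum_sub_distrib, ← sum_add_distrib]
    exact sum_congr rfl fun i _ => by simp only [Pi.sub_apply]; ring
  linarith

lemma risk_add_smul (hY : MemLp (fun ω => Y ω - fstar (X ω)) 2 P₀) {h : 𝒳 → ℝ}
    (hh : MemLp (fun ω => h (X ω)) 2 P₀) (s : ℝ) :
    risk P₀ X Y (fstar + s • h) = risk P₀ X Y fstar
      - 2 * s * ∫ ω, (Y ω - fstar (X ω)) * h (X ω) ∂P₀ + s ^ 2 * ∫ ω, h (X ω) ^ 2 ∂P₀ := by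
  have hcross : Integrable (fun ω => 2 * s * ((Y ω - fstar (X ω)) * h (X ω))) P₀ :=
    (hY.integrable_mul hh).const_mul _
  have hdiff : Integrable (fun ω => (Y ω - fstar (X ω)) ^ 2
      - 2 * s * ((Y ω - fstar (X ω)) * h (X ω))) P₀ := hY.integrable_sq.sub hcross
  unfold risk
  rw [← integral_const_mul, ← integral_const_mul, ← integral_sub hY.integrable_sq hcross,
    ← integral_add hdiff (hh.integrable_sq.const_mul _)]
  refine integral_congr_ae (.of_forall fun ω => ?_)
  simp only [Pi.add_apply, Pi.smul_apply, smul_eq_mul]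
  ring

lemma IsOracle.integral_residual_mul_eq_zero (hstar : IsOracle P₀ X Y F fstar)
    (hY : MemLp (fun ω => Y ω - fstar (X ω)) 2 P₀) {h : 𝒳 → ℝ} (hmem : h ∈ dictSpan F)
    (hh : MemLp (fun ω => h (X ω)) 2 P₀) : ∫ ω, (Y ω - fstar (X ω)) * h (X ω) ∂P₀ = 0 := by
  set I := ∫ ω, (Y ω - fstar (X ω)) * h (X ω) ∂P₀
  set J := ∫ ω, h (X ω) ^ 2 ∂P₀
  have hnonneg : ∀ s : ℝ, 0 ≤ J * (s * s) + -2 * I * s + 0 := fun s => by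
    have hmin := hstar.2 _ (Submodule.add_mem _ hstar.1 (Submodule.smul_mem _ s hmem))
    rw [risk_add_smul hY hh] at hmin
    linarith
  have hdiscrim := discrim_le_zero hnonneg
  unfold discrim at hdiscrim
  exact sq_eq_zero_iff.1 (le_antisymm (by linarith) (sq_nonneg I))

variable [MeasurableSpace 𝒳] {μ : Measure 𝒳}

lemma memLp_of_mem_dictSpan {p : ENNReal} (hF : ∀ j, MemLp (F j) p μ) {f : 𝒳 → ℝ}
    (hf : f ∈ dictSpan F) : MemLp f p μ := by
  unfold dictSpan at hf
  induction hf using Submodule.span_induction with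
  | mem f hf => obtain ⟨j, rfl⟩ := hf; exact hF j
  | zero => exact MemLp.zero
  | add f g _ _ hf hg => exact hf.add hg
  | smul c f _ hf => exact hf.const_smul c

/-- Pythagoras: the residual of the oracle is orthogonal to the span. -/
lemma IsOracle.eLpNorm_sub_sq_eq_excess_risk (hstar : IsOracle P₀ X Y F fstar)
    (hX : HasLaw X μ P₀) (hF : ∀ j, MemLp (F j) 2 μ)
    (hY : MemLp (fun ω => Y ω - fstar (X ω)) 2 P₀) {f : 𝒳 → ℝ} (hf : f ∈ dictSpan F) :
    (eLpNorm (f - fstar) 2 μ).toReal ^ 2 =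
      risk P₀ X Y f - sInf (risk P₀ X Y '' (dictSpan F)) := by
  have hmin : IsLeast (risk P₀ X Y '' (dictSpan F)) (risk P₀ X Y fstar) :=
    ⟨⟨fstar, hstar.1, rfl⟩, Set.forall_mem_image.2 fun g hg => hstar.2 g hg⟩
  have hmem : f - fstar ∈ dictSpan F := Submodule.sub_mem _ hf hstar.1
  have hL := memLp_of_mem_dictSpan hF hmem
  have hLX := memLp_comp_of_hasLaw hX hL
  have hrisk := risk_add_smul hY hLX 1
  rw [one_smul, add_sub_cancel, hstar.integral_residual_mul_eq_zero hY hmem hLX] at hrisk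
  calc (eLpNorm (f - fstar) 2 μ).toReal ^ 2 = ∫ x, (f - fstar) x ^ 2 ∂μ :=
        toReal_eLpNorm_pow hL.aestronglyMeasurable two_ne_zero even_two
    _ = ∫ ω, (f - fstar) (X ω) ^ 2 ∂P₀ :=
        (hX.integral_comp (f := fun x => (f - fstar) x ^ 2) (hL.aestronglyMeasurable.pow 2)).symm
    _ = risk P₀ X Y f - sInf (risk P₀ X Y '' (dictSpan F)) := by
        rw [hmin.csInf_eq, hrisk]
        ring

end Risk

section Residual

variable {𝒳 Ω₀ : Type*} [MeasurableSpace 𝒳] [MeasurableSpace Ω₀] {μ : Measure 𝒳} {P₀ : Measure Ω₀}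
  {X : Ω₀ → 𝒳} {Y : Ω₀ → ℝ} {d : ℕ} {S : Submodule ℝ (𝒳 → ℝ)} {θ : ℝ}

namespace OrthonormalCoordinates

/-- The residual vector `(y - f x) • feature x` of a data point `z = (x, y)`, for the function `f`
with coordinates `t`. Spelling `f x` as `⟪t, feature x⟫` makes it measurable in `z`. -/
noncomputable def residual (C : OrthonormalCoordinates μ S d)
    (t : EuclideanSpace ℝ (Fin d)) (z : 𝒳 × ℝ) : EuclideanSpace ℝ (Fin d) :=
  (z.2 - ⟪t, C.feature z.1⟫) • C.feature z.1

lemma measurable_residual (C : OrthonormalCoordinates μ S d)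
    (t : EuclideanSpace ℝ (Fin d)) : Measurable (C.residual t) := by
  have hfeature : Measurable fun z : 𝒳 × ℝ => C.feature z.1 :=
    C.measurable_feature.comp measurable_fst
  exact (measurable_snd.sub (measurable_const.inner hfeature)).smul hfeature

lemma inner_residual_ae_eq (C : OrthonormalCoordinates μ S d) (hX : HasLaw X μ P₀) (f : S)
    (Y : Ω₀ → ℝ) (u : EuclideanSpace ℝ (Fin d)) :
    (fun ω => ⟪u, C.residual (C.coord f) (X ω, Y ω)⟫) =ᵐ[P₀]
      fun ω => (Y ω - (f : 𝒳 → ℝ) (X ω)) * ⟪u, C.feature (X ω)⟫ := by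
  filter_upwards [ae_comp_of_hasLaw hX C.ae_eq_inner] with ω hω
  rw [residual, real_inner_smul_right, hω f]

lemma integral_inner_residual_eq_zero {M : ℕ} {F : Fin M → 𝒳 → ℝ} {fstar : dictSpan F}
    (C : OrthonormalCoordinates μ (dictSpan F) d) (hX : HasLaw X μ P₀)
    (hF : ∀ j, MemLp (F j) 2 μ) (hstar : IsOracle P₀ X Y F fstar)
    (hY : MemLp (fun ω => Y ω - (fstar : 𝒳 → ℝ) (X ω)) 2 P₀) (u : EuclideanSpace ℝ (Fin d)) :
    ∫ ω, ⟪u, C.residual (C.coord fstar) (X ω, Y ω)⟫ ∂P₀ = 0 := by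
  obtain ⟨h, rfl⟩ := C.coord_surjective u
  rw [integral_congr_ae (C.inner_residual_ae_eq hX fstar Y _), ← hstar.integral_residual_mul_eq_zero
    hY h.2 (memLp_comp_of_hasLaw hX (memLp_of_mem_dictSpan hF h.2))]
  refine integral_congr_ae ?_
  filter_upwards [ae_comp_of_hasLaw hX C.ae_eq_inner] with ω hω
  rw [hω h]

lemma memLp_inner_residual (C : OrthonormalCoordinates μ S d) {f : S}
    (hφ : IsIsotropicL4 θ C.feature μ) (hX : HasLaw X μ P₀)
    (hY : MemLp (fun ω => Y ω - (f : 𝒳 → ℝ) (X ω)) 4 P₀) (u : EuclideanSpace ℝ (Fin d)) :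
    MemLp (fun ω => ⟪u, C.residual (C.coord f) (X ω, Y ω)⟫) 2 P₀ :=
  (memLp_congr_ae (C.inner_residual_ae_eq hX f Y u)).2
    (memLp_two_mul hY ((hφ.comp_hasLaw hX).memLp_inner u))

lemma integral_inner_residual_sq_le (C : OrthonormalCoordinates μ S d) {f : S}
    (hφ : IsIsotropicL4 θ C.feature μ) (hX : HasLaw X μ P₀)
    (hY : MemLp (fun ω => Y ω - (f : 𝒳 → ℝ) (X ω)) 4 P₀) (u : EuclideanSpace ℝ (Fin d)) :
    ∫ ω, ⟪u, C.residual (C.coord f) (X ω, Y ω)⟫ ^ 2 ∂P₀ ≤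
      √(∫ ω, (Y ω - (f : 𝒳 → ℝ) (X ω)) ^ 4 ∂P₀) * θ ^ 2 * ‖u‖ ^ 2 := by
  have hφX := hφ.comp_hasLaw hX
  calc ∫ ω, ⟪u, C.residual (C.coord f) (X ω, Y ω)⟫ ^ 2 ∂P₀
      = ∫ ω, ((Y ω - (f : 𝒳 → ℝ) (X ω)) * ⟪u, C.feature (X ω)⟫) ^ 2 ∂P₀ :=
        integral_congr_ae ((C.inner_residual_ae_eq hX f Y u).mono fun ω hω => by simp only [hω])
    _ ≤ √(∫ ω, (Y ω - (f : 𝒳 → ℝ) (X ω)) ^ 4 ∂P₀) * √(∫ ω, ⟪u, C.feature (X ω)⟫ ^ 4 ∂P₀) :=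
        integral_mul_sq_le_sqrt_mul_sqrt hY (hφX.memLp_inner u)
    _ ≤ √(∫ ω, (Y ω - (f : 𝒳 → ℝ) (X ω)) ^ 4 ∂P₀) * (θ ^ 2 * ‖u‖ ^ 2) := by
        gcongr
        exact Real.sqrt_le_iff.2 ⟨by positivity,
          (hφX.integral_inner_pow_four_le u).trans_eq (by ring)⟩
    _ = _ := (mul_assoc _ _ _).symm

end OrthonormalCoordinates

end Residual

section Excess

lemma rpow_one_div_four_sq {a : ℝ} (ha : 0 ≤ a) : (a ^ (1 / 4 : ℝ)) ^ 2 = √a := by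
  rw [Real.sqrt_eq_rpow, ← Real.rpow_mul_natCast ha]
  norm_num

lemma norm_sq_le_of_basic_inequality {E : Type*} [NormedAddCommGroup E] [InnerProductSpace ℝ E]
    {t Z : E} {n Q C : ℝ} (hn : 0 < n) (hlower : n / 8 * ‖t‖ ^ 2 ≤ Q) (hupper : Q ≤ 2 * ⟪t, Z⟫)
    (hnoise : ‖Z‖ ^ 2 ≤ n * C) : ‖t‖ ^ 2 ≤ 256 * (C / n) := by
  have hmul : n * ‖t‖ * ‖t‖ ≤ 16 * ‖Z‖ * ‖t‖ := by linarith [real_inner_le_norm t Z]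
  have hlinear : n * ‖t‖ ≤ 16 * ‖Z‖ := by
    rcases (norm_nonneg t).eq_or_lt' with ht | ht
    · rw [ht, mul_zero]; positivity
    · exact le_of_mul_le_mul_right hmul ht
  have hsq : n * (n * ‖t‖ ^ 2) ≤ n * (256 * C) := by
    nlinarith [pow_le_pow_left₀ (by positivity) hlinear 2]
  rw [← mul_div_assoc, le_div_iff₀ hn]
  linarith [le_of_mul_le_mul_left hsq hn]

lemma exists_measurableSet_forall_notMem {Ω : Type*} [MeasurableSpace Ω] {P : Measure Ω}
    [IsProbabilityMeasure P] {p : Ω → Prop} {B C : Set Ω} {α β : ℝ} (hp : ∀ᵐ ω ∂P, p ω)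
    (hB : P.real B ≤ α) (hC : P.real C ≤ β) :
    ∃ A : Set Ω, MeasurableSet A ∧ 1 - α - β ≤ P.real A ∧ ∀ ω ∈ A, p ω ∧ ω ∉ B ∧ ω ∉ C := by
  set D : Set Ω := {ω | ¬ p ω} ∪ (B ∪ C) with hD
  have hnull : P.real {ω | ¬ p ω} = 0 := (measureReal_eq_zero_iff).2 (ae_iff.1 hp)
  have hunion : P.real D ≤ α + β := by
    linarith [measureReal_union_le (μ := P) {ω | ¬ p ω} (B ∪ C), measureReal_union_le (μ := P) B C]
  refine ⟨(toMeasurable P D)ᶜ, (measurableSet_toMeasurable P D).compl, ?_, fun ω hω => ?_⟩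
  · rw [probReal_compl_eq_one_sub (measurableSet_toMeasurable P D), measureReal_def,
      measure_toMeasurable, ← measureReal_def]
    linarith
  · have hωD : ω ∉ D := fun h => hω (subset_toMeasurable P D h)
    simpa only [hD, Set.mem_union, Set.mem_ofPred_eq, not_or, not_not] using hωD

lemma IsERM.sum_inner_coord_sq_le {𝒳 : Type*} [MeasurableSpace 𝒳] {μ : Measure 𝒳} {M N d : ℕ}
    {F : Fin M → 𝒳 → ℝ} (C : OrthonormalCoordinates μ (dictSpan F) d) (hN : 0 < N)
    {x : Fin N → 𝒳} {y : Fin N → ℝ} {f g : dictSpan F} (hf : IsERM x y F f)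
    (hx : ∀ i, ∀ h : dictSpan F, (h : 𝒳 → ℝ) (x i) = ⟪C.coord h, C.feature (x i)⟫) :
    ∑ i, ⟪C.coord (f - g), C.feature (x i)⟫ ^ 2 ≤
      2 * ⟪C.coord (f - g), ∑ i, C.residual (C.coord g) (x i, y i)⟫ := by
  simpa only [OrthonormalCoordinates.residual, inner_sum, real_inner_smul_right, ← hx,
    Submodule.coe_sub] using hf.sum_sub_sq_le hN g.2

end Excess

section Sample

variable {𝒳 Ω₀ Ω : Type*} [MeasurableSpace 𝒳] [MeasurableSpace Ω₀] [MeasurableSpace Ω]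
  {μ : Measure 𝒳} {P₀ : Measure Ω₀} {P : Measure Ω} {X : Ω₀ → 𝒳} {Y : Ω₀ → ℝ} {N d : ℕ}
  {Xs : Fin N → Ω → 𝒳} {Ys : Fin N → Ω → ℝ} {θ : ℝ}

lemma hasLaw_of_identDistrib_prodMk {X' : Ω → 𝒳} {Y' : Ω → ℝ} (hX : HasLaw X μ P₀)
    (hid : IdentDistrib (fun ω => (X' ω, Y' ω)) (fun ω => (X ω, Y ω)) P P₀) : HasLaw X' μ P :=
  ⟨measurable_fst.comp_aemeasurable hid.aemeasurable_fst,
    (hid.comp measurable_fst).map_eq.trans hX.map_eq⟩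

lemma OrthonormalCoordinates.measureReal_exists_sum_inner_feature_sq_lt_le [IsProbabilityMeasure P]
    {S : Submodule ℝ (𝒳 → ℝ)} (C : OrthonormalCoordinates μ S d)
    (hφ : IsIsotropicL4 θ C.feature μ) (hθ : 1 ≤ θ) (hXs : ∀ i, HasLaw (Xs i) μ P)
    (hind : iIndepFun Xs P) (hdN : 2176 * θ ^ 8 * d ≤ N) :
    P.real {ω | ∃ t, ∑ i, ⟪t, C.feature (Xs i ω)⟫ ^ 2 < N / 8 * ‖t‖ ^ 2} ≤
      Real.exp (-(N / (64 * θ ^ 4))) := by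
  simpa only [Fintype.card_fin, Function.comp_apply] using measureReal_exists_sum_inner_sq_lt_le
    (hind.comp (fun _ => C.feature) fun _ => C.measurable_feature)
    (fun i => hφ.comp_hasLaw (hXs i)) hθ
    (by rwa [finrank_euclideanSpace_fin, Fintype.card_fin])

lemma OrthonormalCoordinates.measureReal_lt_norm_sum_residual_sq_le [IsProbabilityMeasure P]
    [IsProbabilityMeasure P₀] {M : ℕ} {F : Fin M → 𝒳 → ℝ} {fstar : dictSpan F}
    (C : OrthonormalCoordinates μ (dictSpan F) d) (hφ : IsIsotropicL4 θ C.feature μ)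
    (hX : HasLaw X μ P₀) (hF : ∀ j, MemLp (F j) 2 μ) (hstar : IsOracle P₀ X Y F fstar)
    (hζ : MemLp (fun ω => Y ω - (fstar : 𝒳 → ℝ) (X ω)) 4 P₀)
    (hind : iIndepFun (fun i ω => (Xs i ω, Ys i ω)) P)
    (hid : ∀ i, IdentDistrib (fun ω => (Xs i ω, Ys i ω)) (fun ω => (X ω, Y ω)) P P₀) {x : ℝ}
    (hx : 0 < x) :
    P.real {ω | N * d * (√(∫ ω, (Y ω - (fstar : 𝒳 → ℝ) (X ω)) ^ 4 ∂P₀) * θ ^ 2) * x <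
      ‖∑ i, C.residual (C.coord fstar) (Xs i ω, Ys i ω)‖ ^ 2} ≤ 1 / x := by
  have hW := C.measurable_residual (C.coord fstar)
  have hidW : ∀ i u, IdentDistrib (fun ω => ⟪u, C.residual (C.coord fstar) (Xs i ω, Ys i ω)⟫)
      (fun ω => ⟪u, C.residual (C.coord fstar) (X ω, Y ω)⟫) P P₀ := fun i u =>
    (hid i).comp (measurable_const.inner hW)
  simpa only [Fintype.card_fin, finrank_euclideanSpace_fin, Function.comp_apply] using
    measureReal_lt_norm_sum_sq_le (hind.comp (fun _ => C.residual (C.coord fstar)) fun _ => hW)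
    (fun i u => (hidW i u).memLp_iff.2 (C.memLp_inner_residual hφ hX hζ u))
    (fun i u => (hidW i u).integral_eq.trans <|
      C.integral_inner_residual_eq_zero hX hF hstar (hζ.mono_exponent (by norm_num)) u)
    (fun i u => (hidW i u).sq.integral_eq.trans_le <|
      C.integral_inner_residual_sq_le hφ hX hζ u) hx

theorem IsOracle.exists_event_eLpNorm_sub_sq_le [IsProbabilityMeasure P] [IsProbabilityMeasure P₀]
    {M : ℕ} {F : Fin M → 𝒳 → ℝ} {fstar : 𝒳 → ℝ} {fhat : Ω → 𝒳 → ℝ}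
    (hstar : IsOracle P₀ X Y F fstar) (hX : HasLaw X μ P₀) (hF : ∀ j, MemLp (F j) 2 μ)
    (hθ : 1 ≤ θ) (hnorm : ∀ f ∈ dictSpan F, eLpNorm f 4 μ ≤ ENNReal.ofReal θ * eLpNorm f 2 μ)
    (hζ : MemLp (fun ω => Y ω - fstar (X ω)) 4 P₀) (hN : 0 < N) (hMN : 2176 * θ ^ 8 * M ≤ N)
    (hind : iIndepFun (fun i ω => (Xs i ω, Ys i ω)) P)
    (hid : ∀ i, IdentDistrib (fun ω => (Xs i ω, Ys i ω)) (fun ω => (X ω, Y ω)) P P₀)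
    (hfhat : ∀ ω, IsERM (fun i => Xs i ω) (fun i => Ys i ω) F (fhat ω)) {x : ℝ} (hx : 0 < x) :
    ∃ A : Set Ω, MeasurableSet A ∧ 1 - Real.exp (-(N / (64 * θ ^ 4))) - 1 / x ≤ P.real A ∧
      ∀ ω ∈ A, (eLpNorm (fhat ω - fstar) 2 μ).toReal ^ 2 ≤
        256 * θ ^ 2 * (√(∫ ω, (Y ω - fstar (X ω)) ^ 4 ∂P₀) * M * x / N) := by
  have hS : ∀ f ∈ dictSpan F, MemLp f 2 μ := fun f hf => memLp_of_mem_dictSpan hF hf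
  have : FiniteDimensional ℝ (dictSpan F) :=
    FiniteDimensional.span_of_finite ℝ (Set.finite_range F)
  obtain ⟨d, hd, ⟨C⟩⟩ := exists_orthonormalCoordinates hS
  have hdM : (d : ℝ) ≤ M := by
    exact_mod_cast (hd.trans (finrank_range_le_card F)).trans_eq (Fintype.card_fin M)
  have hφ := C.isIsotropicL4_feature hS (zero_le_one.trans hθ) hnorm
  have hXs : ∀ i, HasLaw (Xs i) μ P := fun i => hasLaw_of_identDistrib_prodMk hX (hid i)
  lift fstar to dictSpan F using hstar.1
  obtain ⟨A, hA, hPA, hgood⟩ := exists_measurableSet_forall_notMem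
    (ae_all_iff.2 fun i => ae_comp_of_hasLaw (hXs i) C.ae_eq_inner)
    (C.measureReal_exists_sum_inner_feature_sq_lt_le hφ hθ hXs
      (hind.comp (fun _ => Prod.fst) fun _ => measurable_fst) (le_trans (by gcongr) hMN))
    (C.measureReal_lt_norm_sum_residual_sq_le hφ hX hF hstar hζ hind hid hx)
  refine ⟨A, hA, hPA, fun ω hω => ?_⟩
  obtain ⟨hexpand, hquad, hnoise⟩ := hgood ω hω
  simp only [Set.mem_ofPred_eq, not_exists, not_lt] at hquad hnoise
  have hERM := hfhat ω
  obtain ⟨f, hf⟩ : ∃ f : dictSpan F, (f : 𝒳 → ℝ) = fhat ω := ⟨⟨_, hERM.1⟩, rfl⟩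
  rw [← hf] at hERM ⊢
  have hN' : (0 : ℝ) < N := Nat.cast_pos.2 hN
  calc (eLpNorm ((f : 𝒳 → ℝ) - (fstar : 𝒳 → ℝ)) 2 μ).toReal ^ 2
      = ‖C.coord (f - fstar)‖ ^ 2 := by rw [C.norm_coord]; rfl
    _ ≤ 256 * (θ ^ 2 * √(∫ ω, (Y ω - (fstar : 𝒳 → ℝ) (X ω)) ^ 4 ∂P₀) * d * x / N) :=
        norm_sq_le_of_basic_inequality hN' (hquad _) (hERM.sum_inner_coord_sq_le C hN hexpand)
          (hnoise.trans_eq (by ring))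
    _ ≤ 256 * (θ ^ 2 * √(∫ ω, (Y ω - (fstar : 𝒳 → ℝ) (X ω)) ^ 4 ∂P₀) * M * x / N) := by gcongr
    _ = _ := by ring

end Sample

end LinearAggregation

theorem mainTheorem3 :
    ∃ c₀ c₁ c₂ : ℝ, 0 < c₀ ∧ 0 < c₁ ∧ 0 < c₂ ∧
      ∀ (𝒳 : Type*) [MeasurableSpace 𝒳] (μ : Measure 𝒳) [IsProbabilityMeasure μ]
        -- the generic couple `(X, Y)`, with `X` distributed according to `μ`
        (Ω₀ : Type*) [MeasurableSpace Ω₀] (P₀ : Measure Ω₀) [IsProbabilityMeasure P₀]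
        (X : Ω₀ → 𝒳) (Y : Ω₀ → ℝ) (_ : HasLaw X μ P₀) (_ : MemLp Y 2 P₀)
        -- the dictionary, the norm equivalence on its span, and the oracle
        (M : ℕ) (F : Fin M → 𝒳 → ℝ) (_ : ∀ j, MemLp (F j) 2 μ)
        (θ₀ : ℝ) (_ : 0 < θ₀)
        (_ : ∀ f ∈ LinearAggregation.dictSpan F,
          eLpNorm f 4 μ ≤ ENNReal.ofReal θ₀ * eLpNorm f 2 μ)
        (fstar : 𝒳 → ℝ) (_ : LinearAggregation.IsOracle P₀ X Y F fstar)
        -- the noise `ζ = Y - f*(X)` and `σ = (𝔼 ζ⁴)^{1/4}`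
        (ζ : Ω₀ → ℝ) (_ : ζ = fun ω => Y ω - fstar (X ω)) (_ : MemLp ζ 4 P₀)
        (σ : ℝ) (_ : σ = (∫ ω, ζ ω ^ 4 ∂P₀) ^ (1 / 4 : ℝ))
        -- the sample: `N` independent copies of `(X, Y)`
        (N : ℕ) (_ : 0 < N) (_ : (c₀ * θ₀ ^ 4) ^ 2 * (M : ℝ) ≤ (N : ℝ))
        (Ω : Type*) [MeasurableSpace Ω] (P : Measure Ω) [IsProbabilityMeasure P]
        (Xs : Fin N → Ω → 𝒳) (Ys : Fin N → Ω → ℝ)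
        (_ : iIndepFun (fun i ω => (Xs i ω, Ys i ω)) P)
        (_ : ∀ i, IdentDistrib (fun ω => (Xs i ω, Ys i ω)) (fun ω => (X ω, Y ω)) P P₀)
        -- any choice, measurable or not, of an empirical risk minimiser for every sample
        (fhat : Ω → 𝒳 → ℝ)
        (_ : ∀ ω, LinearAggregation.IsERM (fun i => Xs i ω) (fun i => Ys i ω) F (fhat ω))
        (x : ℝ) (_ : 0 < x),
        ∃ A : Set Ω, MeasurableSet A ∧
          1 - Real.exp (-((N : ℝ) / (c₁ * θ₀ ^ 8))) - 1 / x ≤ P.real A ∧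
          ∀ ω ∈ A,
            (eLpNorm (fhat ω - fstar) 2 μ).toReal ^ 2 =
                LinearAggregation.risk P₀ X Y (fhat ω) -
                  sInf (LinearAggregation.risk P₀ X Y '' (LinearAggregation.dictSpan F)) ∧
            (eLpNorm (fhat ω - fstar) 2 μ).toReal ^ 2 ≤
              c₂ * θ₀ ^ 12 * (σ ^ 2 * (M : ℝ) * x / (N : ℝ)) := by
  refine ⟨50, 64, 256, by norm_num, by norm_num, by norm_num, ?_⟩
  rintro 𝒳 _ μ _ Ω₀ _ P₀ _ X Y hX _ M F hF θ₀ hθ hnorm fstar hstar _ rfl hζ σ rfl N hN hMN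
    Ω _ P _ Xs Ys hind hid fhat hfhat x hx
  have hexcess := fun ω => hstar.eLpNorm_sub_sq_eq_excess_risk hX hF
    (hζ.mono_exponent (by norm_num)) (hfhat ω).1
  rw [LinearAggregation.rpow_one_div_four_sq (by positivity)]
  rcases lt_or_ge θ₀ 1 with hθ₁ | hθ₁
  · refine ⟨Set.univ, .univ, ?_, fun ω _ => ⟨hexcess ω, ?_⟩⟩
    · rw [probReal_univ]
      linarith [Real.exp_pos (-(N / (64 * θ₀ ^ 8))), one_div_pos.2 hx]
    · have hmem := Submodule.sub_mem _ (hfhat ω).1 hstar.1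
      rw [LinearAggregation.eLpNorm_eq_zero_of_le_ofReal_mul (by norm_num)
        (LinearAggregation.memLp_of_mem_dictSpan hF hmem) hθ₁ (hnorm _ hmem),
        ENNReal.toReal_zero, zero_pow two_ne_zero]
      positivity
  · obtain ⟨A, hA, hPA, hbound⟩ := hstar.exists_event_eLpNorm_sub_sq_le hX hF hθ₁ hnorm hζ hN
      (by nlinarith [show 0 ≤ θ₀ ^ 8 * M by positivity]) hind hid hfhat hx
    refine ⟨A, hA, le_trans ?_ hPA, fun ω hω => ⟨hexcess ω, (hbound ω hω).trans ?_⟩⟩ <;>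
      gcongr <;> norm_num
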